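/- Let $n\ge 2$, $\zeta=e^{2\pi i/n}$, and let $G=\mathbb{C}^*$ act on $X=\mathbb{C}^2\setminus\{0\}$ with weights $(1,n)$, so that $[X/G]=\mathbb{P}(1,n)$, $R(G)_{\mathbb C}=\mathbb{C}[x^{\pm1}]$. The inertia manifold is $I_GX=\coprod_{m\in\mathbb{Z}/n}X^m$, with $X^m$ the fixed locus of $\zeta^m$, and its equivariant K-theory with complex coefficients is $K=\bigoplus_{m\in\mathbb{Z}/n}K_m$, where, in the usual presentation, $$K_0=K_G(X^0)_{\mathbb C}=\frac{\mathbb{C}[x_0^{\pm1}]}{\langle(x_0-1)(x_0^n-1)\rangle},\qquad K_m=K_G(X^m)_{\mathbb C}=\frac{\mathbb{C}[x_m^{\pm1}]}{\langle x_m^n-1\rangle}\quad(m\ne0),$$ with $x\in R(G)_{\mathbb C}$ acting on $K_m$ as $x_m$. The virtual product on $K$ is the bilinear product given by $$x_{m_1}^{a_1}*x_{m_2}^{a_2}=x_{m_1+m_2}^{a_1+a_2}\cdot e_{m_1,m_2}(x_{m_1+m_2})\qquad(a_1,a_2\in\mathbb{Z}),$$ where the Euler class $e_{m_1,m_2}(x)$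 is $1$ if $m_1=0$ or $m_2=0$; it is $(1-x^{-1})^2$ if $m_1,m_2\neq0$ and $m_1+m_2=0$ in $\mathbb{Z}/n$; and it is $1-x^{-1}$ otherwise. For $l\in\mathbb{Z}/n$ let $\mathcal{K}_l$ be the localization of the $R(G)_{\mathbb C}$-module $K$ at the maximal ideal $\mathfrak m_l=\langle x-\zeta^l\rangle$, and let $\mathcal{K}=\bigoplus_{l\in\mathbb{Z}/n}\mathcal{K}_l$. The localization maps give an isomorphism $\Gamma:K\to\mathcal{K}$, through which $\mathcal{K}$ receives the virtual product. Let $1_{ml}$ and $x_{ml}$ be the images of $1\in K_m$ and $x_m\in K_m$ in the summand $(K_m)_{\mathfrak m_l}$ of $\mathcal{K}$. **Proposition.** The elements $x_{00}$ and $1_{ml}$ ($m,l\in\mathbb{Z}/n$) form a $\mathbb{C}$-basis of $\mathcal{K}$. The virtual product on $\mathcal{K}$ is commutative, and it is the bilinear extension of the following products of generators, where indices are taken in $\mathbb{Z}/n$: - $1_{00}*1_{00}=1_{00}$, $\;1_{00}*x_{00}=x_{00}$, $\;x_{00}*x_{00}=2x_{00}-1_{00}$; - $1_{00}*1_{m0}=1_{m0}$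 and $x_{00}*1_{m0}=1_{m0}$ if $m\ne0$; - $1_{m_10}*1_{m_20}=0$ if $m_1,m_2\neq0$; - $1_{0l}*1_{ml}=1_{ml}$ for all $m,l$; - $1_{m_1l}*1_{m_2l}=(1-\zeta^{-l})\,1_{(m_1+m_2)l}$ if $m_1,m_2\ne0$ and $m_1+m_2\neq0$; - $1_{m_1l}*1_{m_2l}=(1-\zeta^{-l})^2\,1_{0l}$ if $m_1,m_2\neq0$ and $m_1+m_2=0$; - $x_{00}*1_{ml}=0$ if $l\neq0$; - $1_{m_1l_1}*1_{m_2l_2}=0$ if $l_1\neq l_2$, for all $m_1,m_2$. -/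

import Mathlib

open scoped LaurentPolynomial

noncomputable section

namespace VirtualKP1n

/-- `ζ = exp(2πi/n)`. -/
def zeta (n : ℕ) : ℂ := Complex.exp (2 * Real.pi * Complex.I / n)

theorem zeta_ne_zero (n : ℕ) : zeta n ≠ 0 := Complex.exp_ne_zero _

/-- The complexified representation ring `R(G) = ℂ[x, x⁻¹]` of `G = ℂ^*`; the character `x` is
`LaurentPolynomial.T 1`. -/
abbrev RG : Type := ℂ[T;T⁻¹]

/-! ### The K-theory of the inertia manifold, with its ordinary product -/

/-- The ideal of relations of `K_G(X^m)`: it is generated by `(x - 1)(x^n - 1)` in the untwisted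
sector `m = 0` and by `x^n - 1` in the twisted sectors. -/
def relIdeal (n : ℕ) (m : ZMod n) : Ideal RG :=
  if m = 0 then
    Ideal.span {(LaurentPolynomial.T 1 - 1) * (LaurentPolynomial.T (n : ℤ) - 1)}
  else Ideal.span {LaurentPolynomial.T (n : ℤ) - 1}

/-- The ring `K_G(X^m)` with complex coefficients, an algebra over `R(G)`.
Its identity is `1_m`, and `x_m` is the class of `x`. -/
def KSector (n : ℕ) (m : ZMod n) : Type := RG ⧸ relIdeal n m

instance (n : ℕ) (m : ZMod n) : CommRing (KSector n m) :=
  inferInstanceAs (CommRing (RG ⧸ relIdeal n m))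

instance (n : ℕ) (m : ZMod n) : Algebra RG (KSector n m) :=
  inferInstanceAs (Algebra RG (RG ⧸ relIdeal n m))

instance (n : ℕ) (m : ZMod n) : Algebra ℂ (KSector n m) :=
  inferInstanceAs (Algebra ℂ (RG ⧸ relIdeal n m))

instance (n : ℕ) (m : ZMod n) : IsScalarTower ℂ RG (KSector n m) :=
  inferInstanceAs (IsScalarTower ℂ RG (RG ⧸ relIdeal n m))

/-- The quotient map `R(G) → K_G(X^m)`. -/
def toSector (n : ℕ) (m : ZMod n) : RG →+* KSector n m := Ideal.Quotient.mk (relIdeal n m)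

theorem toSector_surjective (n : ℕ) (m : ZMod n) : Function.Surjective (toSector n m) :=
  Ideal.Quotient.mk_surjective

theorem toSector_eq_zero {n : ℕ} {m : ZMod n} {f : RG} :
    toSector n m f = 0 ↔ f ∈ relIdeal n m := Ideal.Quotient.eq_zero_iff_mem

theorem smul_toSector (n : ℕ) (m : ZMod n) (f g : RG) :
    f • toSector n m g = toSector n m (f * g) := rfl

/-- `K_G(I_G X) = ⊕_m K_G(X^m)` with complex coefficients (a finite direct sum). -/
abbrev KInertia (n : ℕ) : Type := ∀ m : ZMod n, KSector n m

/-- The element `x_m^a` of `K_G(X^m)`. -/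
def xPow (n : ℕ) (m : ZMod n) (a : ℤ) : KSector n m :=
  toSector n m (LaurentPolynomial.T a)

/-! ### The virtual product on the K-theory of the inertia manifold -/

/-- The Euler class of `S_{m₁} + S_{m₂} - S_{m₁+m₂}`, written as an element of `R(G)`.
For nonzero residues, the sum of the representatives in `{1, …, n-1}` is `n` iff the residues
sum to `0`. -/
def eulerClass (n : ℕ) (m₁ m₂ : ZMod n) : RG :=
  if m₁ = 0 ∨ m₂ = 0 then 1
  else if m₁ + m₂ = 0 then
    1 - 2 * LaurentPolynomial.T (-1) + LaurentPolynomial.T (-2)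
  else 1 - LaurentPolynomial.T (-1)

/-- Multiplication by the Euler class respects the relations in both arguments. -/
theorem mul_eulerClass_mem (n : ℕ) (m₁ m₂ : ZMod n) {f : RG}
    (hf : f ∈ relIdeal n m₁) : eulerClass n m₁ m₂ * f ∈ relIdeal n (m₁ + m₂) := by
  have key : (1 - 2 * LaurentPolynomial.T (-1) + LaurentPolynomial.T (-2) : RG)
      = LaurentPolynomial.T (-2) * (LaurentPolynomial.T 1 - 1) ^ 2 := by
    have h1 : (LaurentPolynomial.T (-2) : RG) * LaurentPolynomial.T 1
        = LaurentPolynomial.T (-1) := by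
      rw [← LaurentPolynomial.T_add]; norm_num
    have h2 : (LaurentPolynomial.T (-1) : RG) * LaurentPolynomial.T 1 = 1 := by
      rw [← LaurentPolynomial.T_add]; norm_num
    linear_combination (2 - LaurentPolynomial.T 1 : RG) * h1 - h2
  by_cases h1 : m₁ = 0
  · subst h1
    have hE : eulerClass n 0 m₂ = 1 := by simp [eulerClass]
    rw [hE, one_mul, zero_add]
    by_cases h2 : m₂ = 0
    · rwa [h2]
    · simp only [relIdeal, if_true, if_neg h2, Ideal.mem_span_singleton] at hf ⊢
      exact (Dvd.intro_left _ rfl).trans hf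
  · by_cases h2 : m₂ = 0
    · subst h2
      have hE : eulerClass n m₁ 0 = 1 := by simp [eulerClass]
      rwa [hE, one_mul, add_zero]
    · simp only [relIdeal, if_neg h1, Ideal.mem_span_singleton] at hf ⊢
      by_cases h3 : m₁ + m₂ = 0
      · have hE : eulerClass n m₁ m₂ =
            1 - 2 * LaurentPolynomial.T (-1) + LaurentPolynomial.T (-2) := by
          simp [eulerClass, h1, h2, h3]
        rw [hE, if_pos h3, key, Ideal.mem_span_singleton]
        obtain ⟨g, rfl⟩ := hf
        exact ⟨LaurentPolynomial.T (-2) * (LaurentPolynomial.T 1 - 1) * g, by ring⟩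
      · rw [if_neg h3, Ideal.mem_span_singleton]
        exact hf.mul_left _

theorem eulerClass_comm (n : ℕ) (m₁ m₂ : ZMod n) :
    eulerClass n m₁ m₂ = eulerClass n m₂ m₁ := by
  simp only [eulerClass, or_comm, add_comm]

/-- The component `K_G(X^{m₁}) × K_G(X^{m₂}) → K_G(X^{m₁+m₂})` of the virtual product: on classes
of Laurent polynomials it is `([f], [g]) ↦ [f g euler(S_{m₁} + S_{m₂} - S_{m₁+m₂})]`. -/
def sectorMul (n : ℕ) (m₁ m₂ : ZMod n) :
    KSector n m₁ →ₗ[RG] KSector n m₂ →ₗ[RG] KSector n (m₁ + m₂) :=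
  Submodule.liftQ (relIdeal n m₁)
    (LinearMap.toSpanSingleton RG (KSector n m₂ →ₗ[RG] KSector n (m₁ + m₂))
      (Submodule.mapQ (relIdeal n m₂) (relIdeal n (m₁ + m₂))
        (LinearMap.mulLeft RG (eulerClass n m₁ m₂)) (fun f hf => by
          have := mul_eulerClass_mem n m₂ m₁ hf
          rwa [eulerClass_comm, add_comm] at this)))
    (fun f hf => by
      rw [LinearMap.mem_ker]
      refine LinearMap.ext fun y => ?_
      obtain ⟨g, rfl⟩ := toSector_surjective n m₂ y
      change toSector n (m₁ + m₂) (f * (eulerClass n m₁ m₂ * g)) = 0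
      rw [toSector_eq_zero]
      have := Ideal.mul_mem_right g _ (mul_eulerClass_mem n m₁ m₂ hf)
      rwa [show f * (eulerClass n m₁ m₂ * g) = eulerClass n m₁ m₂ * f * g by ring])

/-- The defining formula
`x_{m₁}^{a₁} * x_{m₂}^{a₂} = x_{m₁+m₂}^{a₁+a₂} · euler(S_{m₁} + S_{m₂} - S_{m₁+m₂})`. -/
theorem sectorMul_xPow (n : ℕ) (m₁ m₂ : ZMod n) (a₁ a₂ : ℤ) :
    sectorMul n m₁ m₂ (xPow n m₁ a₁) (xPow n m₂ a₂) =
      xPow n (m₁ + m₂) (a₁ + a₂) *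
        toSector n (m₁ + m₂) (eulerClass n m₁ m₂) := by
  change toSector n (m₁ + m₂) (LaurentPolynomial.T a₁ *
    (eulerClass n m₁ m₂ * LaurentPolynomial.T a₂)) = _
  rw [xPow, ← map_mul, LaurentPolynomial.T_add]
  congr 1
  ring

/-- The virtual product on `K_G(I_G X)`, extended bilinearly from the sectors. -/
def virtualMul (n : ℕ) [NeZero n] :
    KInertia n →ₗ[RG] KInertia n →ₗ[RG] KInertia n :=
  ∑ m₁ : ZMod n, ∑ m₂ : ZMod n,
    ((sectorMul n m₁ m₂).compl₁₂ (LinearMap.proj m₁) (LinearMap.proj m₂)).compr₂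
      (LinearMap.single RG (KSector n) (m₁ + m₂))

/-! ### The localizations -/

/-- Evaluation of characters at `ζ^l`. -/
def evalAt (n : ℕ) (l : ZMod n) : RG →+* ℂ :=
  LaurentPolynomial.eval₂ (RingHom.id ℂ)
    (Units.mk0 (zeta n ^ l.val) (pow_ne_zero _ (zeta_ne_zero n)))

/-- The maximal ideal `𝔪_l = ⟨x - ζ^l⟩` of `R(G)`, of elements that vanish at `ζ^l`. -/
def maxIdeal (n : ℕ) (l : ZMod n) : Ideal RG := RingHom.ker (evalAt n l)

instance (n : ℕ) (l : ZMod n) : (maxIdeal n l).IsPrime := RingHom.ker_isPrime _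

/-- `𝒦_l`, the localization of the `R(G)`-module `K_G(I_G X)` at `𝔪_l`. -/
abbrev KLoc (n : ℕ) (l : ZMod n) : Type :=
  LocalizedModule (maxIdeal n l).primeCompl (KInertia n)

/-- `𝒦 = ⊕_l 𝒦_l` (a finite direct sum). -/
abbrev KTotal (n : ℕ) : Type := ∀ l : ZMod n, KLoc n l

/-- The localization map `Γ`. -/
def gammaMap (n : ℕ) : KInertia n →ₗ[RG] KTotal n :=
  LinearMap.pi fun l => LocalizedModule.mkLinearMap (maxIdeal n l).primeCompl (KInertia n)

/-- The element `x - ζ^l` of `R(G)`. -/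
def linFactor (n : ℕ) (l : ZMod n) : RG :=
  LaurentPolynomial.T 1 - LaurentPolynomial.C (zeta n ^ l.val)

theorem evalAt_linFactor (n : ℕ) (l k : ZMod n) :
    evalAt n k (linFactor n l) = zeta n ^ k.val - zeta n ^ l.val := by
  simp [evalAt, linFactor]

/-- `𝔪_l` is generated by `x - ζ^l`. -/
theorem maxIdeal_eq_span (n : ℕ) (l : ZMod n) :
    maxIdeal n l = Ideal.span {linFactor n l} := by
  refine le_antisymm (fun f hf => ?_) ?_
  · obtain ⟨k, p, hp⟩ := LaurentPolynomial.exists_T_pow f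
    have h0 : evalAt n l f = 0 := hf
    have hroot : p.IsRoot (zeta n ^ l.val) := by
      have h : evalAt n l (Polynomial.toLaurent p) = 0 := by rw [hp, map_mul, h0, zero_mul]
      simpa [evalAt, Polynomial.IsRoot, Polynomial.eval₂_id] using h
    have hdvd : linFactor n l ∣ f * LaurentPolynomial.T k := by
      have := map_dvd (Polynomial.toLaurent (R := ℂ)) (Polynomial.dvd_iff_isRoot.2 hroot)
      rw [hp] at this
      simpa [linFactor] using this
    rw [Ideal.mem_span_singleton]
    exact ((LaurentPolynomial.isUnit_T (R := ℂ) k).dvd_mul_right).1 hdvd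
  · rw [Ideal.span_singleton_le_iff_mem, maxIdeal, RingHom.mem_ker, evalAt_linFactor, sub_self]

instance (n : ℕ) (l : ZMod n) : (maxIdeal n l).IsMaximal :=
  RingHom.ker_isMaximal_of_surjective _ fun c =>
    ⟨LaurentPolynomial.C c, by simp [evalAt]⟩

theorem isPrimitiveRoot_zeta (n : ℕ) [NeZero n] : IsPrimitiveRoot (zeta n) n :=
  Complex.isPrimitiveRoot_exp n (NeZero.ne n)

theorem linFactor_notMem (n : ℕ) [NeZero n] {l k : ZMod n} (h : l ≠ k) :
    linFactor n l ∉ maxIdeal n k := by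
  rw [maxIdeal, RingHom.mem_ker, evalAt_linFactor, sub_eq_zero]
  intro h'
  exact h (ZMod.val_injective n
    ((isPrimitiveRoot_zeta n).pow_inj (ZMod.val_lt k) (ZMod.val_lt l) h').symm)

theorem pow_sub_one_eq_prod (n : ℕ) [NeZero n] :
    (LaurentPolynomial.T (n : ℤ) - 1 : RG) = ∏ l : ZMod n, linFactor n l := by
  have h := congrArg (Polynomial.toLaurent (R := ℂ))
    (Polynomial.X_pow_sub_one_eq_prod (NeZero.pos n) (isPrimitiveRoot_zeta n))
  rw [map_sub, Polynomial.toLaurent_X_pow, map_one, map_prod] at h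
  rw [h]
  symm
  refine Finset.prod_bij (fun l _ => zeta n ^ l.val) (fun l _ => ?_) (fun l _ k _ hlk => ?_)
    (fun η hη => ?_) (fun l _ => ?_)
  · rw [Polynomial.mem_nthRootsFinset (NeZero.pos n), ← pow_mul, mul_comm, pow_mul,
      (isPrimitiveRoot_zeta n).pow_eq_one, one_pow]
  · exact ZMod.val_injective n
      ((isPrimitiveRoot_zeta n).pow_inj (ZMod.val_lt l) (ZMod.val_lt k) hlk)
  · rw [Polynomial.mem_nthRootsFinset (NeZero.pos n)] at hη
    obtain ⟨i, hi, rfl⟩ := (isPrimitiveRoot_zeta n).eq_pow_of_pow_eq_one hη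
    exact ⟨(i : ZMod n), Finset.mem_univ _, by rw [ZMod.val_cast_of_lt hi]⟩
  · simp [linFactor]

/-- The product of the `(x - ζ^k)^2` over `k ≠ l`. -/
def cofactor (n : ℕ) [NeZero n] (l : ZMod n) : RG :=
  ∏ k ∈ Finset.univ.erase l, linFactor n k ^ 2

theorem cofactor_notMem (n : ℕ) [NeZero n] (l : ZMod n) : cofactor n l ∉ maxIdeal n l := by
  intro h
  obtain ⟨k, hk, hmem⟩ := (Ideal.IsPrime.prod_mem_iff (p := maxIdeal n l)).1 h
  exact linFactor_notMem n (Finset.ne_of_mem_erase hk)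
    (Ideal.IsPrime.mem_of_pow_mem inferInstance _ hmem)

theorem cofactor_smul (n : ℕ) [NeZero n] (l : ZMod n) (a : KInertia n) :
    (linFactor n l ^ 2 * cofactor n l) • a = 0 := by
  have hprod : linFactor n l ^ 2 * cofactor n l = (LaurentPolynomial.T (n : ℤ) - 1) ^ 2 := by
    rw [cofactor, Finset.mul_prod_erase _ (fun k => linFactor n k ^ 2) (Finset.mem_univ l),
      Finset.prod_pow, pow_sub_one_eq_prod]
  rw [hprod]
  have hdvd : (LaurentPolynomial.T 1 - 1 : RG) ∣ LaurentPolynomial.T (n : ℤ) - 1 := by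
    rw [pow_sub_one_eq_prod]
    have : linFactor n 0 = LaurentPolynomial.T 1 - 1 := by simp [linFactor]
    rw [← this]
    exact Finset.dvd_prod_of_mem _ (Finset.mem_univ _)
  funext m
  obtain ⟨f, hf⟩ := toSector_surjective n m (a m)
  rw [Pi.smul_apply, ← hf, smul_toSector, Pi.zero_apply, toSector_eq_zero]
  refine Ideal.mul_mem_right _ _ ?_
  unfold relIdeal
  split_ifs
  · rw [Ideal.mem_span_singleton, pow_two]
    exact mul_dvd_mul_right hdvd _
  · rw [Ideal.mem_span_singleton]
    exact dvd_pow_self _ two_ne_zero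

/-- An element outside `𝔪_l` is invertible modulo `(x - ζ^l)^2`. -/
theorem exists_inv_mod (n : ℕ) (l : ZMod n) {s : RG} (hs : s ∉ maxIdeal n l) :
    ∃ u v : RG, u * s + v * linFactor n l ^ 2 = 1 := by
  have h : IsCoprime s (linFactor n l) := by
    obtain ⟨y, i, hi, hy⟩ := Ideal.IsMaximal.exists_inv (I := maxIdeal n l) inferInstance hs
    rw [maxIdeal_eq_span, Ideal.mem_span_singleton'] at hi
    obtain ⟨w, rfl⟩ := hi
    exact ⟨y, w, hy⟩
  exact h.pow_right (n := 2)

theorem gammaMap_injective (n : ℕ) [NeZero n] : Function.Injective (gammaMap n) := by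
  refine (injective_iff_map_eq_zero (gammaMap n)).2 fun a ha => ?_
  have hl : ∀ l : ZMod n, ∃ v : RG, (v * linFactor n l ^ 2) • a = a := by
    intro l
    have h1 : LocalizedModule.mk a (1 : (maxIdeal n l).primeCompl) = LocalizedModule.mk 0 1 := by
      have := congrFun ha l
      simpa [gammaMap] using this
    obtain ⟨s, hs⟩ := LocalizedModule.mk_eq.1 h1
    have hs' : (s : RG) • a = 0 := by simpa [Submonoid.smul_def] using hs
    obtain ⟨u, v, huv⟩ := exists_inv_mod n l s.2
    refine ⟨v, ?_⟩
    rw [← sub_eq_zero, ← neg_eq_zero, neg_sub]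
    calc a - (v * linFactor n l ^ 2) • a
        = (u * s + v * linFactor n l ^ 2) • a - (v * linFactor n l ^ 2) • a := by
          rw [huv, one_smul]
      _ = 0 := by rw [add_smul, add_sub_cancel_right, mul_smul, hs', smul_zero]
  have hS : ∀ S : Finset (ZMod n), ∃ v : RG, (v * ∏ l ∈ S, linFactor n l ^ 2) • a = a := by
    intro S
    induction S using Finset.induction_on with
    | empty => exact ⟨1, by simp⟩
    | insert l S hlS ih =>
      obtain ⟨v, hv⟩ := ih
      obtain ⟨w, hw⟩ := hl l
      refine ⟨w * v, ?_⟩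
      rw [Finset.prod_insert hlS]
      calc (w * v * (linFactor n l ^ 2 * ∏ l ∈ S, linFactor n l ^ 2)) • a
          = (w * linFactor n l ^ 2) • (v * ∏ l ∈ S, linFactor n l ^ 2) • a := by
            rw [smul_smul]; congr 1; ring
        _ = a := by rw [hv, hw]
  obtain ⟨v, hv⟩ := hS Finset.univ
  rw [← Finset.mul_prod_erase _ (fun k => linFactor n k ^ 2) (Finset.mem_univ 0)] at hv
  rw [← hv, mul_smul]
  exact (congrArg (v • ·) (cofactor_smul n 0 a)).trans (smul_zero v)

theorem gammaMap_surjective (n : ℕ) [NeZero n] : Function.Surjective (gammaMap n) := by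
  have key : ∀ (l : ZMod n) (y : KLoc n l), ∃ a, gammaMap n a = Pi.single l y := by
    intro l y
    obtain ⟨b, s, rfl⟩ : ∃ b s, LocalizedModule.mk b s = y :=
      LocalizedModule.induction_on (fun b s => ⟨b, s, rfl⟩) y
    have hsw : (s : RG) * cofactor n l ∉ maxIdeal n l := fun h =>
      ((inferInstance : (maxIdeal n l).IsPrime).mem_or_mem h).elim s.2 (cofactor_notMem n l)
    obtain ⟨u, v, huv⟩ := exists_inv_mod n l hsw
    refine ⟨(u * cofactor n l) • b, ?_⟩
    funext k
    change LocalizedModule.mk ((u * cofactor n l) • b) (1 : (maxIdeal n k).primeCompl) = _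
    by_cases hk : k = l
    · subst hk
      rw [Pi.single_eq_same, LocalizedModule.mk_eq]
      refine ⟨⟨cofactor n k, cofactor_notMem n k⟩, ?_⟩
      simp only [Submonoid.smul_def, one_smul]
      rw [smul_smul, smul_smul, ← sub_eq_zero, ← sub_smul]
      have : cofactor n k * s * (u * cofactor n k) - cofactor n k
          = -v * (linFactor n k ^ 2 * cofactor n k) := by
        linear_combination cofactor n k * huv
      rw [this, mul_smul, cofactor_smul, smul_zero]
    · rw [Pi.single_eq_of_ne hk, ← LocalizedModule.zero_mk 1, LocalizedModule.mk_eq]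
      refine ⟨⟨linFactor n l ^ 2, fun h => linFactor_notMem n (Ne.symm hk)
        (Ideal.IsPrime.mem_of_pow_mem inferInstance _ h)⟩, ?_⟩
      simp only [Submonoid.smul_def, one_smul, smul_zero]
      rw [smul_smul, show linFactor n l ^ 2 * (u * cofactor n l)
        = u * (linFactor n l ^ 2 * cofactor n l) by ring, mul_smul, cofactor_smul, smul_zero]
  intro y
  choose a ha using fun l => key l (y l)
  refine ⟨∑ l, a l, ?_⟩
  rw [map_sum]
  simp only [ha]
  exact Finset.univ_sum_single y

/-- The localization isomorphism `Γ : K_G(I_G X) ≃ 𝒦`. -/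
def gamma (n : ℕ) [NeZero n] : KInertia n ≃ₗ[RG] KTotal n :=
  LinearEquiv.ofBijective (gammaMap n) ⟨gammaMap_injective n, gammaMap_surjective n⟩

/-- The virtual product on `𝒦`: the transport of the virtual product on `K_G(I_G X)` along `Γ`. -/
def locMul (n : ℕ) [NeZero n] : KTotal n →ₗ[RG] KTotal n →ₗ[RG] KTotal n :=
  ((virtualMul n).compl₁₂ (gamma n).symm.toLinearMap (gamma n).symm.toLinearMap).compr₂
    (gamma n).toLinearMap

/-! ### The generators of `𝒦` -/

/-- The component in the summand `𝒦_l` of the image under `Γ` of `c ∈ K_G(X^m)`, as an element of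
`𝒦`; that is, the image of `c` in the summand `K_G(X^m)_{𝔪_l}` of `𝒦`. -/
def component (n : ℕ) [NeZero n] (m l : ZMod n) (c : KSector n m) : KTotal n :=
  Pi.single l (gamma n (Pi.single m c) l)

/-- The generator `1_{ml}`. -/
def oneGen (n : ℕ) [NeZero n] (m l : ZMod n) : KTotal n := component n m l 1

/-- The generator `x_{ml}`. -/
def xGen (n : ℕ) [NeZero n] (m l : ZMod n) : KTotal n := component n m l (xPow n m 1)

/-- The family that consists of `x_{00}` and all the `1_{ml}`. -/
def generators (n : ℕ) [NeZero n] : Option (ZMod n × ZMod n) → KTotal n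
  | none => xGen n 0 0
  | some (m, l) => oneGen n m l

end VirtualKP1n

end

open VirtualKP1n

/-!
The relations of all sectors divide `(x^n - 1)^2 = ∏ (x - ζ^k)^2`. By the Chinese remainder theorem
there is for each `l` a Laurent polynomial `idem l` that is `1` modulo `(x - ζ^l)^2` and `0` modulo
`(x - ζ^k)^2` for `k ≠ l`. It acts on `𝒦` as the projection onto the summand `𝒦_l` (`idem_smul`),
so `1_{ml} = idem l • Γ(1_m)`. Since the virtual product is `R(G)`-bilinear, the idempotents pass
through it, which gives every product of the `1_{ml}` at once (`locMul_oneGen`):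
`1_{m₁l₁} * 1_{m₂l₂}` is `0` if `l₁ ≠ l₂`, and otherwise the Euler class times `1_{(m₁+m₂)l}`.

It remains to know how `R(G)` acts on the generators. If `(m, l) ≠ (0, 0)`, the relation of the
sector `m` has only a simple root at `ζ^l`, so that a Laurent polynomial acts on `1_{ml}` as its
value at `ζ^l` (`smul_oneGen`). On `1_{00}` only `(x - 1)^2` acts as zero, whence the extra
generator `x_{00} = x • 1_{00}` and the relation `x_{00} * x_{00} = 2 x_{00} - 1_{00}`.

The generators span because `1_m` generates `K_G(X^m)` over `R(G)`. They are independent because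
evaluation of the sectors at the roots of unity (`coord`) gives functionals dual to the `1_{ml}`,
which leaves a multiple of `x_{00} - 1_{00}`, and this element is nonzero (`xGen_ne_oneGen`).
-/

namespace VirtualKP1n

variable {n : ℕ}

/-! ### The idempotents that split off the localizations -/

theorem linFactor_sq_smul_loc [NeZero n] (l : ZMod n) (y : KLoc n l) :
    linFactor n l ^ 2 • y = 0 := by
  induction y using LocalizedModule.induction_on with
  | _ a s =>
    rw [LocalizedModule.smul'_mk, ← LocalizedModule.zero_mk 1, LocalizedModule.mk_eq]
    refine ⟨⟨cofactor n l, cofactor_notMem n l⟩, ?_⟩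
    simp only [Submonoid.smul_def, smul_zero, one_smul]
    rw [smul_smul, mul_comm, cofactor_smul]

theorem exists_mul_cofactor_add [NeZero n] (l : ZMod n) :
    ∃ u : RG, ∃ v : RG, u * cofactor n l + v * linFactor n l ^ 2 = 1 :=
  exists_inv_mod n l (cofactor_notMem n l)

/-- A Laurent polynomial that acts on `𝒦` as the projection onto the summand `𝒦_l`: it is
divisible by `(x - ζ^k)^2` for `k ≠ l`, and is `1` modulo `(x - ζ^l)^2`. -/
noncomputable def idem [NeZero n] (l : ZMod n) : RG :=
  (exists_mul_cofactor_add l).choose * cofactor n l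

theorem cofactor_dvd_idem [NeZero n] (l : ZMod n) : cofactor n l ∣ idem l :=
  Dvd.intro_left _ rfl

theorem linFactor_sq_dvd_one_sub_idem [NeZero n] (l : ZMod n) :
    linFactor n l ^ 2 ∣ 1 - idem l := by
  obtain ⟨v, hv⟩ := (exists_mul_cofactor_add l).choose_spec
  exact ⟨v, by rw [← hv, idem]; ring⟩

theorem linFactor_sq_dvd_idem [NeZero n] {k l : ZMod n} (h : k ≠ l) :
    linFactor n k ^ 2 ∣ idem l :=
  (Finset.dvd_prod_of_mem (fun k => linFactor n k ^ 2)
    (Finset.mem_erase.2 ⟨h, Finset.mem_univ k⟩)).trans (cofactor_dvd_idem l)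

theorem evalAt_idem [NeZero n] (k l : ZMod n) :
    evalAt n k (idem l) = if k = l then 1 else 0 := by
  have h0 : evalAt n k (linFactor n k ^ 2) = 0 := by
    rw [map_pow, evalAt_linFactor, sub_self, zero_pow two_ne_zero]
  split_ifs with h
  · subst h
    obtain ⟨v, hv⟩ := linFactor_sq_dvd_one_sub_idem k
    have := congrArg (evalAt n k) hv
    rw [map_mul, h0, zero_mul, map_sub, map_one, sub_eq_zero] at this
    exact this.symm
  · obtain ⟨v, hv⟩ := linFactor_sq_dvd_idem h
    rw [hv, map_mul, h0, zero_mul]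

theorem idem_smul [NeZero n] (l : ZMod n) (t : KTotal n) :
    idem l • t = Pi.single l (t l) := by
  funext k
  rw [Pi.smul_apply]
  by_cases h : k = l
  · subst h
    obtain ⟨v, hv⟩ := linFactor_sq_dvd_one_sub_idem k
    rw [Pi.single_eq_same]
    nth_rewrite 2 [← one_smul RG (t k)]
    rw [← sub_add_cancel 1 (idem k), hv, add_smul, mul_comm, mul_smul, linFactor_sq_smul_loc,
      smul_zero, zero_add]
  · obtain ⟨v, hv⟩ := linFactor_sq_dvd_idem h
    rw [Pi.single_eq_of_ne h, hv, mul_comm, mul_smul, linFactor_sq_smul_loc, smul_zero]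

theorem sum_idem_smul [NeZero n] (t : KTotal n) : ∑ l : ZMod n, idem l • t = t := by
  simp only [idem_smul]
  exact Finset.univ_sum_single t

theorem idem_smul_idem_smul [NeZero n] (k l : ZMod n) (t : KTotal n) :
    idem k • idem l • t = if k = l then idem l • t else 0 := by
  split_ifs with h
  · subst h
    simp [idem_smul]
  · rw [idem_smul k, idem_smul l, Pi.single_eq_of_ne h, Pi.single_zero]

theorem component_eq [NeZero n] (m l : ZMod n) (c : KSector n m) :
    component n m l c = idem l • gamma n (Pi.single m c) :=
  (idem_smul l _).symm

theorem component_toSector [NeZero n] (m l : ZMod n) (f : RG) :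
    component n m l (toSector n m f) = f • oneGen n m l := by
  have h : (Pi.single m (toSector n m f) : KInertia n) = f • Pi.single m 1 := by
    rw [← Pi.single_smul, ← map_one (toSector n m), smul_toSector, mul_one]
  rw [oneGen, component_eq, component_eq, h, map_smul, smul_comm]

theorem xGen_eq [NeZero n] (m l : ZMod n) :
    xGen n m l = (LaurentPolynomial.T 1 : RG) • oneGen n m l :=
  component_toSector m l _

/-! ### The virtual product in terms of the sectors -/

theorem sectorMul_toSector (m₁ m₂ : ZMod n) (f g : RG) :
    sectorMul n m₁ m₂ (toSector n m₁ f) (toSector n m₂ g) =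
      toSector n (m₁ + m₂) (f * (eulerClass n m₁ m₂ * g)) := rfl

theorem virtualMul_single [NeZero n] (m₁ m₂ : ZMod n) (c₁ : KSector n m₁) (c₂ : KSector n m₂) :
    virtualMul n (Pi.single m₁ c₁) (Pi.single m₂ c₂) =
      Pi.single (m₁ + m₂) (sectorMul n m₁ m₂ c₁ c₂) := by
  simp only [virtualMul, LinearMap.sum_apply, LinearMap.compr₂_apply, LinearMap.compl₁₂_apply,
    LinearMap.proj_apply, LinearMap.coe_single]
  rw [Finset.sum_eq_single m₁, Finset.sum_eq_single m₂, Pi.single_eq_same, Pi.single_eq_same]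
  · intro k _ hk
    rw [Pi.single_eq_of_ne hk, map_zero, Pi.single_zero]
  · simp
  · intro k _ hk
    simp [Pi.single_eq_of_ne hk]
  · simp

theorem virtualMul_comm [NeZero n] (a b : KInertia n) :
    virtualMul n a b = virtualMul n b a := by
  rw [← Finset.univ_sum_single a, ← Finset.univ_sum_single b]
  simp only [map_sum, LinearMap.sum_apply]
  rw [Finset.sum_comm]
  refine Finset.sum_congr rfl fun m₁ _ => Finset.sum_congr rfl fun m₂ _ => ?_
  obtain ⟨f, hf⟩ := toSector_surjective n m₁ (a m₁)
  obtain ⟨g, hg⟩ := toSector_surjective n m₂ (b m₂)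
  have key : ∀ (m m' : ZMod n) (p p' : RG), m = m' → p = p' →
      (Pi.single m (toSector n m p) : KInertia n) = Pi.single m' (toSector n m' p') := by
    rintro m _ p _ rfl rfl; rfl
  rw [← hf, ← hg, virtualMul_single, virtualMul_single, sectorMul_toSector, sectorMul_toSector]
  apply key _ _ _ _ (add_comm _ _)
  rw [eulerClass_comm n m₁ m₂]
  ring

theorem locMul_gamma [NeZero n] (a b : KInertia n) :
    locMul n (gamma n a) (gamma n b) = gamma n (virtualMul n a b) := by
  simp [locMul]

theorem locMul_comm [NeZero n] (a b : KTotal n) : locMul n a b = locMul n b a := by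
  simp [locMul, virtualMul_comm]

/-- Since the product is `R(G)`-bilinear, it is compatible with the idempotents, so that the
summands `𝒦_l` are orthogonal and each carries the product of the sectors. -/
theorem locMul_oneGen [NeZero n] (m₁ m₂ l₁ l₂ : ZMod n) :
    locMul n (oneGen n m₁ l₁) (oneGen n m₂ l₂) =
      if l₁ = l₂ then eulerClass n m₁ m₂ • oneGen n (m₁ + m₂) l₂ else 0 := by
  have h : sectorMul n m₁ m₂ 1 1 = toSector n (m₁ + m₂) (eulerClass n m₁ m₂) := by
    have := sectorMul_toSector m₁ m₂ 1 1
    rwa [one_mul, mul_one, map_one (toSector n m₁), map_one (toSector n m₂)] at this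
  rw [← component_toSector, oneGen, oneGen, component_eq, component_eq, component_eq, map_smul,
    map_smul, LinearMap.smul_apply, locMul_gamma, virtualMul_single, h, smul_comm,
    idem_smul_idem_smul]

/-! ### The action of `R(G)` on the generators -/

theorem C_smul [NeZero n] (c : ℂ) (t : KTotal n) : (LaurentPolynomial.C c : RG) • t = c • t := by
  rw [← algebraMap_smul RG c t]
  rfl

theorem smul_oneGen_eq_zero [NeZero n] {m l : ZMod n} {f : RG}
    (h : f * idem l ∈ relIdeal n m) : f • oneGen n m l = 0 := by
  rw [oneGen, component_eq, ← map_smul, ← map_smul, ← Pi.single_smul, ← Pi.single_smul, smul_smul,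
    ← map_one (toSector n m), smul_toSector, mul_one, toSector_eq_zero.2 h, Pi.single_zero,
    map_zero]

theorem linFactor_zero : linFactor n 0 = LaurentPolynomial.T 1 - 1 := by simp [linFactor]

/-- Except in `K_G(X^0)` at `1`, all relations have simple roots, so `x` acts on `1_{ml}` as the
scalar `ζ^l`. -/
theorem linFactor_smul_oneGen [NeZero n] {m l : ZMod n} (h : m ≠ 0 ∨ l ≠ 0) :
    linFactor n l • oneGen n m l = 0 := by
  apply smul_oneGen_eq_zero
  have hprod : ∏ k : ZMod n, linFactor n k ∣
      linFactor n l * ∏ k ∈ Finset.univ.erase l, linFactor n k := by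
    rw [Finset.mul_prod_erase _ _ (Finset.mem_univ l)]
  unfold relIdeal
  split_ifs with hm
  · have hl : l ≠ 0 := h.resolve_left (not_not.2 hm)
    rw [Ideal.mem_span_singleton, ← linFactor_zero, pow_sub_one_eq_prod]
    refine Dvd.dvd.trans ?_ (mul_dvd_mul_left _ (cofactor_dvd_idem l))
    rw [cofactor, Finset.prod_pow, ← Finset.mul_prod_erase _ _ (Finset.mem_univ l), pow_two,
      mul_left_comm]
    exact mul_dvd_mul_left _ (mul_dvd_mul_right (Finset.dvd_prod_of_mem _
      (Finset.mem_erase.2 ⟨hl.symm, Finset.mem_univ _⟩)) _)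
  · rw [Ideal.mem_span_singleton, pow_sub_one_eq_prod]
    refine hprod.trans (mul_dvd_mul_left _ (Dvd.dvd.trans ?_ (cofactor_dvd_idem l)))
    rw [cofactor, Finset.prod_pow]
    exact dvd_pow_self _ two_ne_zero

theorem linFactor_sq_smul_oneGen [NeZero n] (m l : ZMod n) :
    linFactor n l ^ 2 • oneGen n m l = 0 := by
  rw [oneGen, component, ← Pi.single_smul, linFactor_sq_smul_loc, Pi.single_zero]

theorem exists_eq_C_add (l : ZMod n) (f : RG) :
    ∃ g : RG, f = LaurentPolynomial.C (evalAt n l f) + g * linFactor n l := by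
  have h : f - LaurentPolynomial.C (evalAt n l f) ∈ maxIdeal n l := by
    rw [maxIdeal, RingHom.mem_ker, map_sub, sub_eq_zero]
    simp [evalAt]
  rw [maxIdeal_eq_span, Ideal.mem_span_singleton'] at h
  obtain ⟨g, hg⟩ := h
  exact ⟨g, by rw [hg]; ring⟩

theorem smul_oneGen [NeZero n] {m l : ZMod n} (h : m ≠ 0 ∨ l ≠ 0) (f : RG) :
    f • oneGen n m l = evalAt n l f • oneGen n m l := by
  obtain ⟨g, hg⟩ := exists_eq_C_add l f
  nth_rewrite 1 [hg]
  rw [add_smul, mul_smul, linFactor_smul_oneGen h, smul_zero, add_zero, C_smul]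

theorem smul_oneGen_zero [NeZero n] (f : RG) :
    ∃ a b : ℂ, f • oneGen n 0 0 = a • oneGen n 0 0 + b • xGen n 0 0 := by
  obtain ⟨g, hg⟩ := exists_eq_C_add (0 : ZMod n) f
  obtain ⟨h, hh⟩ := exists_eq_C_add (0 : ZMod n) g
  refine ⟨evalAt n 0 f - evalAt n 0 g, evalAt n 0 g, ?_⟩
  have key : f = LaurentPolynomial.C (evalAt n 0 f - evalAt n 0 g)
      + LaurentPolynomial.C (evalAt n 0 g) * LaurentPolynomial.T 1 + h * linFactor n 0 ^ 2 := by
    rw [linFactor_zero] at *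
    rw [map_sub]
    linear_combination hg + (LaurentPolynomial.T 1 - 1) * hh
  rw [xGen_eq]
  nth_rewrite 1 [key]
  rw [add_smul, add_smul, mul_smul, mul_smul, linFactor_sq_smul_oneGen, smul_zero,
    add_zero, C_smul, C_smul]

theorem evalAt_T (l : ZMod n) (a : ℤ) :
    evalAt n l (LaurentPolynomial.T a) = (zeta n ^ l.val) ^ a := by
  simp [evalAt]

/-! ### The basis -/

theorem span_generators [NeZero n] : Submodule.span ℂ (Set.range (generators n)) = ⊤ := by
  rw [eq_top_iff]
  rintro t -
  have hone : ∀ m l, oneGen n m l ∈ Submodule.span ℂ (Set.range (generators n)) := fun m l =>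
    Submodule.subset_span ⟨some (m, l), rfl⟩
  have hx : xGen n 0 0 ∈ Submodule.span ℂ (Set.range (generators n)) :=
    Submodule.subset_span ⟨none, rfl⟩
  obtain ⟨a, rfl⟩ := (gamma n).surjective t
  rw [← Finset.univ_sum_single a, map_sum]
  refine Submodule.sum_mem _ fun m _ => ?_
  rw [← sum_idem_smul (gamma n (Pi.single m (a m)))]
  refine Submodule.sum_mem _ fun l _ => ?_
  obtain ⟨f, hf⟩ := toSector_surjective n m (a m)
  rw [← component_eq, ← hf, component_toSector]
  by_cases h : m ≠ 0 ∨ l ≠ 0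
  · rw [smul_oneGen h]
    exact Submodule.smul_mem _ _ (hone m l)
  · obtain ⟨rfl, rfl⟩ : m = 0 ∧ l = 0 := by simpa using h
    obtain ⟨c, d, hcd⟩ := smul_oneGen_zero (n := n) f
    rw [hcd]
    exact Submodule.add_mem _ (Submodule.smul_mem _ _ (hone 0 0)) (Submodule.smul_mem _ _ hx)

theorem evalAt_eq_zero_of_mem [NeZero n] {m : ZMod n} {f : RG} (l : ZMod n)
    (hf : f ∈ relIdeal n m) : evalAt n l f = 0 := by
  have h0 : evalAt n l (LaurentPolynomial.T (n : ℤ) - 1) = 0 := by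
    rw [map_sub, map_one, evalAt_T, zpow_natCast, ← pow_mul, mul_comm, pow_mul,
      (isPrimitiveRoot_zeta n).pow_eq_one, one_pow, sub_self]
  unfold relIdeal at hf
  split_ifs at hf <;> obtain ⟨g, rfl⟩ := Ideal.mem_span_singleton.1 hf
  · rw [map_mul, map_mul, h0, mul_zero, zero_mul]
  · rw [map_mul, h0, zero_mul]

/-- Evaluation at `ζ^l` on `K_G(X^m)`. -/
noncomputable def sectorEval (n : ℕ) [NeZero n] (m l : ZMod n) : KSector n m →+* ℂ :=
  Ideal.Quotient.lift (relIdeal n m) (evalAt n l) fun _ hf => evalAt_eq_zero_of_mem l hf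

theorem sectorEval_toSector [NeZero n] (m l : ZMod n) (f : RG) :
    sectorEval n m l (toSector n m f) = evalAt n l f := rfl

/-- The functional on `𝒦` that evaluates the sector `m` at `ζ^l`; on the `1_{ml}` these
functionals form a dual family. -/
noncomputable def coord (n : ℕ) [NeZero n] (m l : ZMod n) : KTotal n →+ ℂ :=
  (sectorEval n m l).toAddMonoidHom.comp
    ((Pi.evalAddMonoidHom (KSector n) m).comp (gamma n).symm.toAddEquiv.toAddMonoidHom)

theorem coord_apply [NeZero n] (m l : ZMod n) (t : KTotal n) :
    coord n m l t = sectorEval n m l ((gamma n).symm t m) := rfl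

theorem coord_smul [NeZero n] (m l : ZMod n) (f : RG) (t : KTotal n) :
    coord n m l (f • t) = evalAt n l f * coord n m l t := by
  rw [coord_apply, coord_apply, map_smul, Pi.smul_apply]
  obtain ⟨g, hg⟩ := toSector_surjective n m ((gamma n).symm t m)
  rw [← hg, smul_toSector, sectorEval_toSector, sectorEval_toSector, map_mul]

theorem coord_smul_complex [NeZero n] (m l : ZMod n) (c : ℂ) (t : KTotal n) :
    coord n m l (c • t) = c * coord n m l t := by
  rw [← C_smul, coord_smul]
  simp [evalAt]

theorem coord_oneGen [NeZero n] (m l m' l' : ZMod n) :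
    coord n m l (oneGen n m' l') = if m = m' ∧ l = l' then 1 else 0 := by
  rw [oneGen, component_eq, coord_smul, evalAt_idem, coord_apply, LinearEquiv.symm_apply_apply]
  by_cases hm : m = m'
  · subst hm
    simp
  · simp [hm]

/-- `sub_smul` for `𝒦`; the general lemma does not unify, as the module and additive group structures
of a localized module are separate instances. -/
theorem sub_smul_total [NeZero n] (f g : RG) (t : KTotal n) :
    (f - g) • t = f • t - g • t := by
  rw [eq_sub_iff_add_eq, ← add_smul, sub_add_cancel]

theorem linFactor_ne_zero (l : ZMod n) : linFactor n l ≠ 0 := by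
  have h : linFactor n l =
      Polynomial.toLaurent (Polynomial.X - Polynomial.C (zeta n ^ l.val)) := by
    simp [linFactor]
  rw [h, Polynomial.toLaurent_ne_zero]
  exact Polynomial.X_sub_C_ne_zero _

/-- The relation of the untwisted sector has a double root at `1`, so `x - 1` does not annihilate
`1_{00}`. -/
theorem xGen_ne_oneGen [NeZero n] : xGen n 0 0 ≠ oneGen n 0 0 := by
  intro h
  have h1 : linFactor n 0 • oneGen n 0 0 = 0 := by
    rw [linFactor_zero, sub_smul_total, one_smul, ← xGen_eq, h, sub_self]
  rw [oneGen, component_eq, ← map_smul, ← map_smul, LinearEquiv.map_eq_zero_iff,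
    ← map_one (toSector n 0), ← Pi.single_smul, ← Pi.single_smul, smul_toSector, smul_toSector,
    Pi.single_eq_zero_iff, toSector_eq_zero, mul_one, relIdeal, if_pos rfl,
    Ideal.mem_span_singleton, ← linFactor_zero (n := n),
    mul_dvd_mul_iff_left (linFactor_ne_zero 0)] at h1
  -- Cancelling `x - 1` makes the idempotent divisible by `x^n - 1`, but it is `1` at `x = 1`.
  have h2 := map_dvd (evalAt n 0) h1
  rw [evalAt_idem, if_pos rfl, map_sub, map_one, evalAt_T] at h2
  simp at h2

theorem linearIndependent_generators [NeZero n] : LinearIndependent ℂ (generators n) := by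
  rw [Fintype.linearIndependent_iff]
  intro g hg
  rw [Fintype.sum_option, Fintype.sum_prod_type] at hg
  simp only [generators] at hg
  have hx : ∀ m l : ZMod n, coord n m l (xGen n 0 0) = if m = 0 ∧ l = 0 then 1 else 0 := by
    intro m l
    rw [xGen_eq, coord_smul, coord_oneGen, evalAt_T]
    by_cases h : m = 0 ∧ l = 0
    · simp [h]
    · simp [h]
  have hc : ∀ m l : ZMod n, g none * (if m = 0 ∧ l = 0 then 1 else 0) + g (some (m, l)) = 0 := by
    intro m l
    have h := congrArg (coord n m l) hg
    rw [map_add, map_zero, coord_smul_complex, hx] at h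
    simp only [map_sum, coord_smul_complex, coord_oneGen, ite_and, mul_ite, mul_one, mul_zero] at h
    simpa [ite_and] using h
  have hne : ∀ m l : ZMod n, ¬ (m = 0 ∧ l = 0) → g (some (m, l)) = 0 := by
    intro m l h
    simpa [h] using hc m l
  have h00 : g (some (0, 0)) = - g none := by
    have := hc 0 0
    simp only [and_self, if_true, mul_one] at this
    linear_combination this
  have hsum : ∑ m : ZMod n, ∑ l : ZMod n, g (some (m, l)) • oneGen n m l =
      g (some (0, 0)) • oneGen n 0 0 := by
    rw [Finset.sum_eq_single 0, Finset.sum_eq_single 0]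
    · intro l _ hl
      rw [hne _ _ (fun h => hl h.2), zero_smul]
    · simp
    · intro m _ hm
      exact Finset.sum_eq_zero fun l _ => by rw [hne _ _ (fun h => hm h.1), zero_smul]
    · simp
  rw [hsum, h00] at hg
  have hnone : g none = 0 := by
    by_contra h
    have h' : g none • xGen n 0 0 = g none • oneGen n 0 0 := by
      calc g none • xGen n 0 0 = g none • xGen n 0 0 + (- g none + g none) • oneGen n 0 0 := by
            rw [neg_add_cancel, zero_smul, add_zero]
        _ = g none • oneGen n 0 0 := by rw [add_smul, ← add_assoc, hg, zero_add]
    have h2 := congrArg ((g none)⁻¹ • ·) h'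
    simp only [smul_smul, inv_mul_cancel₀ h, one_smul] at h2
    exact xGen_ne_oneGen h2
  rintro (_ | ⟨m, l⟩)
  · exact hnone
  · by_cases h : m = 0 ∧ l = 0
    · rw [h.1, h.2, h00, hnone, neg_zero]
    · exact hne m l h

/-! ### The multiplication table -/

theorem eulerClass_zero_left (m : ZMod n) : eulerClass n 0 m = 1 := by simp [eulerClass]

theorem locMul_xGen_oneGen [NeZero n] (m l : ZMod n) :
    locMul n (xGen n 0 0) (oneGen n m l) =
      if l = 0 then (LaurentPolynomial.T 1 : RG) • oneGen n m l else 0 := by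
  rw [xGen_eq, map_smul, LinearMap.smul_apply, locMul_oneGen, eulerClass_zero_left, one_smul,
    zero_add]
  split_ifs with h h' h' <;> simp_all

theorem locMul_xGen_xGen [NeZero n] :
    locMul n (xGen n 0 0) (xGen n 0 0) = (2 : ℂ) • xGen n 0 0 - oneGen n 0 0 := by
  have h : (LaurentPolynomial.T 1 * LaurentPolynomial.T 1 : RG) + 1 =
      LaurentPolynomial.C 2 * LaurentPolynomial.T 1 + linFactor n 0 ^ 2 := by
    rw [linFactor_zero, map_ofNat]
    ring
  nth_rewrite 2 [xGen_eq]
  rw [map_smul, locMul_xGen_oneGen, if_pos rfl, eq_sub_iff_add_eq, xGen_eq, smul_smul]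
  nth_rewrite 2 [← one_smul RG (oneGen n 0 0)]
  rw [← add_smul, h, add_smul, linFactor_sq_smul_oneGen, add_zero, mul_smul, C_smul]

theorem evalAt_eulerClass [NeZero n] (l : ZMod n) {m₁ m₂ : ZMod n} (h₁ : m₁ ≠ 0) (h₂ : m₂ ≠ 0) :
    evalAt n l (eulerClass n m₁ m₂) =
      if m₁ + m₂ = 0 then (1 - (zeta n ^ l.val)⁻¹) ^ 2 else 1 - (zeta n ^ l.val)⁻¹ := by
  rw [eulerClass, if_neg (not_or.2 ⟨h₁, h₂⟩)]
  split_ifs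
  · rw [map_add, map_sub, map_mul, map_one, map_ofNat, evalAt_T, evalAt_T, zpow_neg_one,
      zpow_neg, zpow_ofNat]
    ring
  · rw [map_sub, map_one, evalAt_T, zpow_neg_one]

theorem locMul_oneGen_of_add_ne_zero [NeZero n] (l : ZMod n) {m₁ m₂ : ZMod n}
    (h₁ : m₁ ≠ 0) (h₂ : m₂ ≠ 0) (h : m₁ + m₂ ≠ 0) :
    locMul n (oneGen n m₁ l) (oneGen n m₂ l) =
      (1 - (zeta n ^ l.val)⁻¹) • oneGen n (m₁ + m₂) l := by
  rw [locMul_oneGen, if_pos rfl, smul_oneGen (Or.inl h), evalAt_eulerClass l h₁ h₂, if_neg h]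

theorem eulerClass_of_add_eq_zero {m₁ m₂ : ZMod n} (h₁ : m₁ ≠ 0) (h₂ : m₂ ≠ 0)
    (h : m₁ + m₂ = 0) :
    eulerClass n m₁ m₂ = LaurentPolynomial.T (-2) * linFactor n 0 ^ 2 := by
  have e1 : (LaurentPolynomial.T (-2) : RG) * LaurentPolynomial.T 1
      = LaurentPolynomial.T (-1) := by
    rw [← LaurentPolynomial.T_add]; norm_num
  have e2 : (LaurentPolynomial.T (-1) : RG) * LaurentPolynomial.T 1 = 1 := by
    rw [← LaurentPolynomial.T_add]; norm_num
  rw [eulerClass, if_neg (not_or.2 ⟨h₁, h₂⟩), if_pos h, linFactor_zero]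
  linear_combination (2 - LaurentPolynomial.T 1 : RG) * e1 - e2

/-- At `l = 0` the scalar vanishes, and so does the product: the Euler class of two mutually inverse
sectors is divisible by the square of `x - 1`, which kills `𝒦_0`. -/
theorem locMul_oneGen_of_add_eq_zero [NeZero n] (l : ZMod n) {m₁ m₂ : ZMod n}
    (h₁ : m₁ ≠ 0) (h₂ : m₂ ≠ 0) (h : m₁ + m₂ = 0) :
    locMul n (oneGen n m₁ l) (oneGen n m₂ l) =
      (1 - (zeta n ^ l.val)⁻¹) ^ 2 • oneGen n 0 l := by
  rw [locMul_oneGen, if_pos rfl, h]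
  by_cases hl : l = 0
  · subst hl
    rw [eulerClass_of_add_eq_zero h₁ h₂ h, mul_smul, linFactor_sq_smul_oneGen, smul_zero]
    simp
  · rw [smul_oneGen (Or.inr hl), evalAt_eulerClass l h₁ h₂, if_pos h]

end VirtualKP1n

theorem proposition5p1 (n : ℕ) [NeZero n] (hn : 2 ≤ n) :
    -- the generators form a basis, and the (bilinear) product is commutative
    LinearIndependent ℂ (generators n) ∧
    Submodule.span ℂ (Set.range (generators n)) = ⊤ ∧
    (∀ a b : KTotal n, locMul n a b = locMul n b a) ∧
    -- products in the summand `𝒦_0`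
    locMul n (oneGen n 0 0) (oneGen n 0 0) = oneGen n 0 0 ∧
    locMul n (oneGen n 0 0) (xGen n 0 0) = xGen n 0 0 ∧
    (∀ m : ZMod n, m ≠ 0 → locMul n (oneGen n 0 0) (oneGen n m 0) = oneGen n m 0) ∧
    locMul n (xGen n 0 0) (xGen n 0 0) = (2 : ℂ) • xGen n 0 0 - oneGen n 0 0 ∧
    (∀ m : ZMod n, m ≠ 0 → locMul n (xGen n 0 0) (oneGen n m 0) = oneGen n m 0) ∧
    (∀ m₁ m₂ : ZMod n, m₁ ≠ 0 → m₂ ≠ 0 →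
      locMul n (oneGen n m₁ 0) (oneGen n m₂ 0) = 0) ∧
    -- products in a summand `𝒦_l`
    (∀ m l : ZMod n, locMul n (oneGen n 0 l) (oneGen n m l) = oneGen n m l) ∧
    (∀ l m₁ m₂ : ZMod n, m₁ ≠ 0 → m₂ ≠ 0 → m₁ + m₂ ≠ 0 →
      locMul n (oneGen n m₁ l) (oneGen n m₂ l) =
        (1 - (zeta n ^ l.val)⁻¹) • oneGen n (m₁ + m₂) l) ∧
    (∀ l m₁ m₂ : ZMod n, m₁ ≠ 0 → m₂ ≠ 0 → m₁ + m₂ = 0 →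
      locMul n (oneGen n m₁ l) (oneGen n m₂ l) =
        (1 - (zeta n ^ l.val)⁻¹) ^ 2 • oneGen n 0 l) ∧
    -- products of generators from different summands
    (∀ m l : ZMod n, l ≠ 0 → locMul n (xGen n 0 0) (oneGen n m l) = 0) ∧
    (∀ m₁ m₂ l₁ l₂ : ZMod n, l₁ ≠ l₂ →
      locMul n (oneGen n m₁ l₁) (oneGen n m₂ l₂) = 0) := by

  have hzero : (1 - (zeta n ^ (0 : ZMod n).val)⁻¹ : ℂ) = 0 := by simp
  have hx : ∀ m : ZMod n, m ≠ 0 → locMul n (xGen n 0 0) (oneGen n m 0) = oneGen n m 0 := by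
    intro m hm
    rw [locMul_xGen_oneGen, if_pos rfl, smul_oneGen (Or.inl hm), evalAt_T]
    simp
  have hone : ∀ m l : ZMod n, locMul n (oneGen n 0 l) (oneGen n m l) = oneGen n m l := by
    intro m l
    rw [locMul_oneGen, if_pos rfl, eulerClass_zero_left, one_smul, zero_add]
  have h10 : locMul n (oneGen n 0 0) (xGen n 0 0) = xGen n 0 0 := by
    rw [xGen_eq, map_smul, hone]
  refine ⟨linearIndependent_generators, span_generators, locMul_comm, hone 0 0, h10,
    fun m _ => hone m 0, locMul_xGen_xGen, hx, fun m₁ m₂ h₁ h₂ => ?_, hone,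
    fun l m₁ m₂ => locMul_oneGen_of_add_ne_zero l, fun l m₁ m₂ => locMul_oneGen_of_add_eq_zero l,
    fun m l hl => by rw [locMul_xGen_oneGen, if_neg hl],
    fun m₁ m₂ l₁ l₂ hl => by rw [locMul_oneGen, if_neg hl]⟩
  by_cases h : m₁ + m₂ = 0
  · rw [locMul_oneGen_of_add_eq_zero 0 h₁ h₂ h, hzero, zero_pow two_ne_zero, zero_smul]
  · rw [locMul_oneGen_of_add_ne_zero 0 h₁ h₂ h, hzero, zero_smul]
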